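/- Let $\mathbf k$ be an algebraically closed field and let $F_3$ be the free group on $A,B,C$. Let $\mathfrak X_3=\mathfrak X(F_3,\mathrm{SL}_2)\subset \mathbf k^{F_3}$ be the character variety, i.e. the set of all characters $\chi_\rho(g)=\operatorname{tr}\rho(g)$ of representations $\rho:F_3\to \mathrm{SL}_2(\mathbf k)$, with ring of functions $\mathcal O_{\mathfrak X_3}$ the $\mathbf k$-algebra of functions on $\mathfrak X_3$ generated by the traces $t_g:\chi\mapsto\chi(g)$, $g\in F_3$. Then: 1. $\mathfrak X_3$ is an irreducible affine variety: $\mathcal O_{\mathfrak X_3}$ is a finitely generated $\mathbf k$-algebra and an integral domain, and every $\mathbf k$-algebra homomorphism $\mathcal O_{\mathfrak X_3}\to\mathbf k$ is evaluation at a unique point of $\mathfrak X_3$. 2. The six traces $t_A,t_B,t_C,t_{AB},t_{AC},t_{BC}$ form a transcendence basis of $\mathcal O_{\mathfrak X_3}$ over $\mathbf k$, and $\mathcal O_{\mathfrak X_3}$ is an extension of degree $2$ of the polynomial ring $\mathbf k[t_A,t_B,t_C,t_{AB},t_{AC},t_{BC}]$; more precisely, it is a free module of rank $2$ over it. 3.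 The morphism $\pi=(t_A,t_B,t_C,t_{AB},t_{AC},t_{BC}):\mathfrak X_3\to\mathbf k^6$ is a ramified double cover. It is surjective (and finite, by 2). Writing $(x,y,z,w,v,u)$ for the coordinates of $\mathbf k^6$ in this order, and $$X=wz+vy+ux-xyz,\qquad Y=-x^2-y^2-z^2+uyz+vxz+wxy-uvw-u^2-v^2-w^2+4,\qquad \Delta=X^2+4Y,$$ the fibre of $\pi$ over $p\in\mathbf k^6$ has exactly two points if $\Delta(p)\neq0$ and exactly one point if $\Delta(p)=0$; moreover, both cases occur. -/

import Mathlib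

/-- The character `g ↦ tr ρ(g)` of a representation `ρ : Γ → SL_n(k)`. -/
def repCharacter {Γ : Type*} [Group Γ] {n : ℕ} {k : Type*} [Field k]
    (ρ : Γ →* Matrix.SpecialLinearGroup (Fin n) k) : Γ → k :=
  fun g => Matrix.trace (ρ g : Matrix (Fin n) (Fin n) k)

/-- The character variety `𝔛(Γ, SL_n)` over `k`: the image of the character map
`Hom(Γ, SL_n(k)) → k^Γ`, `ρ ↦ χ_ρ`. -/
def CharacterVariety (Γ : Type*) [Group Γ] (n : ℕ) (k : Type*) [Field k] : Set (Γ → k) :=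
  Set.range (repCharacter : (Γ →* Matrix.SpecialLinearGroup (Fin n) k) → Γ → k)

/-- The ring of functions of `𝔛(Γ, SL_n)`: the `k`-algebra of functions on the character variety
generated by the trace functions `t_g : χ ↦ χ(g)`, `g ∈ Γ`. -/
def characterCoordRing (Γ : Type*) [Group Γ] (n : ℕ) (k : Type*) [Field k] :
    Subalgebra k (CharacterVariety Γ n k → k) :=
  Algebra.adjoin k (Set.range fun (g : Γ) (χ : CharacterVariety Γ n k) => χ.1 g)

/-- The trace function `t_g`, as an element of the ring of functions. -/
def traceFn {Γ : Type*} [Group Γ] (n : ℕ) (k : Type*) [Field k] (g : Γ) :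
    characterCoordRing Γ n k :=
  ⟨fun χ => χ.1 g, Algebra.subset_adjoin ⟨g, rfl⟩⟩

/-- With `A, B, C` the free generators of `F_3`, the six words `A, B, C, AB, AC, BC`. -/
def sixWords : Fin 6 → FreeGroup (Fin 3) :=
  ![FreeGroup.of 0, FreeGroup.of 1, FreeGroup.of 2,
    FreeGroup.of 0 * FreeGroup.of 1, FreeGroup.of 0 * FreeGroup.of 2,
    FreeGroup.of 1 * FreeGroup.of 2]

/-- The six trace functions `t_A, t_B, t_C, t_AB, t_AC, t_BC` on `𝔛(F_3, SL_2)`. -/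
def sixTraces (k : Type*) [Field k] : Fin 6 → characterCoordRing (FreeGroup (Fin 3)) 2 k :=
  fun i => traceFn 2 k (sixWords i)

/-- The morphism `(t_A, t_B, t_C, t_AB, t_AC, t_BC) : 𝔛(F_3, SL_2) → k^6`. -/
def sixTraceMap (k : Type*) [Field k] :
    CharacterVariety (FreeGroup (Fin 3)) 2 k → (Fin 6 → k) :=
  fun χ i => (sixTraces k i).1 χ

/-- The subring `k[t_A, t_B, t_C, t_AB, t_AC, t_BC]` of the ring of functions. -/
def sixTraceSubring (k : Type*) [Field k] :
    Subalgebra k (characterCoordRing (FreeGroup (Fin 3)) 2 k) :=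
  Algebra.adjoin k (Set.range (sixTraces k))

/-- The discriminant `X² + 4Y` of the quadratic equation `P² = X P + Y` of `P = t_ABC`, in the
coordinates `(x, y, z, w, v, u) = (t_A, t_B, t_C, t_AB, t_AC, t_BC)` of `k^6`. -/
def branchDiscr {k : Type*} [Field k] (p : Fin 6 → k) : k :=
  let x := p 0; let y := p 1; let z := p 2; let w := p 3; let v := p 4; let u := p 5
  (w * z + v * y + u * x - x * y * z) ^ 2 +
    4 * (-x ^ 2 - y ^ 2 - z ^ 2 + u * y * z + v * x * z + w * x * y - u * v * w
      - u ^ 2 - v ^ 2 - w ^ 2 + 4)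

/-! The variety is the hypersurface `t² = X t + Y` in `k⁷`, where `t = t_ABC`. Cayley–Hamilton and
its polarisation rewrite every word as a combination of `1, A, B, C, AB, AC, BC, ABC` with
coefficients polynomial in the six traces. Taking traces, `1` and `t` span the ring over those
polynomials (`exists_eq_add_mul_tripleTrace`), and `t` satisfies the quadratic (`trace_mul_mul_sq`).

Conversely, every point of the hypersurface is a character (`exists_character`): any six values are
traces of some triple, and transposing its generators exchanges the two roots. This gives the
fibres, the points of the ring and, as `Δ` is not identically zero, the independence of `1` and `t`.

The ring is a domain because the norm form `a² + abX - b²Y` is multiplicative and anisotropic: the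
quadratic has no root in the polynomial ring (`quadratic_ne_zero`), hence none in its fraction
field. No argument divides by 2, so characteristic 2 is included. -/

open Matrix

/-! ### Trace identities for 2×2 matrices -/

section TraceIdentities

variable {K : Type*} [CommRing K]

/-- The quadratic equation satisfied by `tr (ABC)`, with coefficients in the traces of the
shorter words, for matrices of determinant one. -/
theorem trace_mul_mul_sq (A B C : Matrix (Fin 2) (Fin 2) K)
    (hA : A.det = 1) (hB : B.det = 1) (hC : C.det = 1) :
    (A * B * C).trace ^ 2 =
      ((A * B).trace * C.trace + (A * C).trace * B.trace + (B * C).trace * A.trace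
        - A.trace * B.trace * C.trace) * (A * B * C).trace +
      (-A.trace ^ 2 - B.trace ^ 2 - C.trace ^ 2 + (B * C).trace * B.trace * C.trace
        + (A * C).trace * A.trace * C.trace + (A * B).trace * A.trace * B.trace
        - (B * C).trace * (A * C).trace * (A * B).trace
        - (B * C).trace ^ 2 - (A * C).trace ^ 2 - (A * B).trace ^ 2 + 4) := by
  -- Inserting determinants as factors makes this a polynomial identity in the twelve entries, valid
  -- for all matrices.
  have key : (A * B * C).trace ^ 2 =
      ((A * B).trace * C.trace + (A * C).trace * B.trace + (B * C).trace * A.trace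
        - A.trace * B.trace * C.trace) * (A * B * C).trace +
      (-A.trace ^ 2 * B.det * C.det - B.trace ^ 2 * A.det * C.det - C.trace ^ 2 * A.det * B.det
        + (B * C).trace * B.trace * C.trace * A.det
        + (A * C).trace * A.trace * C.trace * B.det + (A * B).trace * A.trace * B.trace * C.det
        - (B * C).trace * (A * C).trace * (A * B).trace
        - (B * C).trace ^ 2 * A.det - (A * C).trace ^ 2 * B.det - (A * B).trace ^ 2 * C.det
        + 4 * A.det * B.det * C.det) := by
    simp only [Matrix.det_fin_two, Matrix.trace_fin_two, Matrix.mul_apply, Fin.sum_univ_two]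
    ring
  rw [hA, hB, hC] at key
  simpa using key

/-- The sum of the traces of the two cyclic products of three matrices. -/
theorem trace_mul_mul_add_trace_mul_mul (A B C : Matrix (Fin 2) (Fin 2) K) :
    (A * B * C).trace + (C * B * A).trace =
      (A * B).trace * C.trace + (A * C).trace * B.trace + (B * C).trace * A.trace
        - A.trace * B.trace * C.trace := by
  simp only [Matrix.trace_fin_two, Matrix.mul_apply, Fin.sum_univ_two]
  ring

theorem mul_self_of_det_eq_one (A : Matrix (Fin 2) (Fin 2) K) (hA : A.det = 1) :
    A * A = A.trace • A - 1 := by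
  rw [Matrix.det_fin_two] at hA
  ext i j
  fin_cases i <;> fin_cases j <;>
    simp [Matrix.mul_apply, Fin.sum_univ_two, Matrix.trace_fin_two] <;>
    first | ring1 | linear_combination -hA

/-- This is Cayley–Hamilton polarised, the polar form of the determinant being `tr A tr B - tr AB`.
It serves as the rule for swapping two generators. -/
theorem mul_comm_trace (A B : Matrix (Fin 2) (Fin 2) K) :
    B * A = -(A * B) + A.trace • B + B.trace • A
      + ((A * B).trace - A.trace * B.trace) • (1 : Matrix (Fin 2) (Fin 2) K) := by
  ext i j
  fin_cases i <;> fin_cases j <;>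
    simp [Matrix.mul_apply, Fin.sum_univ_two, Matrix.trace_fin_two] <;> ring

end TraceIdentities

/-! ### Triples with six prescribed traces -/

section Existence

variable {k : Type*} [Field k] [IsAlgClosed k]

theorem exists_quadratic_root {a : k} (ha : a ≠ 0) (b c : k) :
    ∃ s, a * s ^ 2 + b * s + c = 0 := by
  obtain ⟨s, hs⟩ := IsAlgClosed.exists_root
    (Polynomial.C a * Polynomial.X ^ 2 + Polynomial.C b * Polynomial.X + Polynomial.C c)
    (by rw [Polynomial.degree_quadratic ha]; decide)
  exact ⟨s, by simpa using hs⟩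

/-- Solvability of `b₂ b₃ = m`, `c₂ c₃ = n`, `b₂ c₃ + b₃ c₂ = s`. -/
theorem exists_off_diagonal (m n s : k) :
    ∃ b₂ b₃ c₂ c₃ : k, b₂ * b₃ = m ∧ c₂ * c₃ = n ∧ b₂ * c₃ + b₃ * c₂ = s := by
  by_cases hm : m = 0
  · by_cases hn : n = 0
    · exact ⟨0, 1, s, 0, by simp [hm], by simp [hn], by simp⟩
    -- Normalise `c₂ = 1`, `c₃ = n`; the third equation gives `b₃ = s - n b₂`, and the first becomes
    -- a quadratic in `b₂`.
    · obtain ⟨r, hr⟩ := exists_quadratic_root hn (-s) m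
      exact ⟨r, s - n * r, 1, n, by linear_combination -hr, by ring, by ring⟩
  · obtain ⟨r, hr⟩ := exists_quadratic_root hm (-s) n
    exact ⟨1, m, r, s - m * r, by ring, by linear_combination -hr, by ring⟩

/-- Let `a` be an eigenvalue for the trace `x`. If `2a ≠ x`, take `A` diagonal: the traces with and
without `A` fix the diagonals of `B` and `C`, and `exists_off_diagonal` does the rest. If `2a = x`,
take `A` scalar when `w = ay` and `v = az`, and otherwise a Jordan block, which forces the
lower-left entries `w - ay` of `B` and `v - az` of `C`. -/
theorem exists_matrix_entries (x y z w v u : k) :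
    ∃ a₁ a₂ a₃ a₄ b₁ b₂ b₃ b₄ c₁ c₂ c₃ c₄ : k,
      (a₁ * a₄ - a₂ * a₃ = 1 ∧ b₁ * b₄ - b₂ * b₃ = 1 ∧ c₁ * c₄ - c₂ * c₃ = 1) ∧
      a₁ + a₄ = x ∧ b₁ + b₄ = y ∧ c₁ + c₄ = z ∧
      a₁ * b₁ + a₂ * b₃ + (a₃ * b₂ + a₄ * b₄) = w ∧
      a₁ * c₁ + a₂ * c₃ + (a₃ * c₂ + a₄ * c₄) = v ∧
      b₁ * c₁ + b₂ * c₃ + (b₃ * c₂ + b₄ * c₄) = u := by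
  obtain ⟨a, ha⟩ := exists_quadratic_root (one_ne_zero (α := k)) (-x) 1
  have hax : a * (x - a) = 1 := by linear_combination -ha
  by_cases hd : 2 * a = x
  · have haa : a * a = 1 := by rw [← hd] at hax; linear_combination hax
    by_cases hb : w = a * y
    · by_cases hc : v = a * z
      · refine ⟨a, 0, 0, a, 0, -1, 1, y, ?_⟩
        obtain ⟨s, hs⟩ := exists_quadratic_root (one_ne_zero (α := k)) (-z) 1
        refine ⟨s, u - y * (z - s), 0, z - s, ⟨by linear_combination haa, by ring,
          by linear_combination -hs⟩, by linear_combination hd, by ring, by ring, ?_, ?_, ?_⟩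
        · rw [hb]; ring
        · rw [hc]; ring
        · ring
      · have hc' : v - a * z ≠ 0 := sub_ne_zero.2 hc
        generalize hγ : v - a * z = γ at *
        obtain ⟨b, hb'⟩ := exists_quadratic_root (one_ne_zero (α := k)) (-y) 1
        refine ⟨a, 1, 0, a, b, (u - (y - b) * z) / γ, 0, y - b,
          0, -1 / γ, γ, z, ⟨by linear_combination haa,
          by linear_combination -hb', ?_⟩, by linear_combination hd, by ring, by ring, ?_, ?_, ?_⟩
        · field_simp; ring
        · rw [hb]; ring
        · linear_combination -hγ
        · field_simp; ring
    · have hb' : w - a * y ≠ 0 := sub_ne_zero.2 hb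
      by_cases hc : v = a * z
      · obtain ⟨c, hc'⟩ := exists_quadratic_root (one_ne_zero (α := k)) (-z) 1
        generalize hβ : w - a * y = β at *
        refine ⟨a, 1, 0, a, 0, -1 / β, β, y,
          c, (u - y * (z - c)) / β, 0, z - c, ⟨by linear_combination haa, ?_,
          by linear_combination -hc'⟩, by linear_combination hd, by ring, by ring, ?_, ?_, ?_⟩
        · field_simp; ring
        · linear_combination -hβ
        · rw [hc]; ring
        · field_simp; ring
      · have hc' : v - a * z ≠ 0 := sub_ne_zero.2 hc
        generalize hβ : w - a * y = β at *
        generalize hγ : v - a * z = γ at *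
        -- The condition `tr BC = u` multiplied by `βγ`, as a quadratic in the upper-left entry `s`
        -- of `C`.
        obtain ⟨s, hs⟩ := exists_quadratic_root (a := -β ^ 2) (by simpa using hb')
          (β ^ 2 * z - y * β * γ) (y * z * β * γ - γ ^ 2 - β ^ 2 - u * β * γ)
        refine ⟨a, 1, 0, a, 0, -1 / β, β, y, s, (s * (z - s) - 1) / γ, γ, z - s,
          ⟨by linear_combination haa, ?_, ?_⟩, by linear_combination hd, by ring, by ring,
          by linear_combination -hβ, by linear_combination -hγ, ?_⟩
        · field_simp; ring
        · field_simp; ring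
        · field_simp; linear_combination hs
  · have hd' : 2 * a - x ≠ 0 := sub_ne_zero.2 hd
    generalize hδ : 2 * a - x = δ at *
    obtain ⟨b₁, hb₁⟩ : ∃ b, b * δ = w - (x - a) * y := ⟨_, div_mul_cancel₀ _ hd'⟩
    obtain ⟨c₁, hc₁⟩ : ∃ c, c * δ = v - (x - a) * z := ⟨_, div_mul_cancel₀ _ hd'⟩
    obtain ⟨b₂, b₃, c₂, c₃, h1, h2, h3⟩ := exists_off_diagonal (b₁ * (y - b₁) - 1)
      (c₁ * (z - c₁) - 1) (u - b₁ * c₁ - (y - b₁) * (z - c₁))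
    refine ⟨a, 0, 0, x - a, b₁, b₂, b₃, y - b₁, c₁, c₂, c₃, z - c₁,
      ⟨by linear_combination hax, by linear_combination -h1, by linear_combination -h2⟩,
      by ring, by ring, by ring, ?_, ?_, by linear_combination h3⟩
    · linear_combination hb₁ + b₁ * hδ
    · linear_combination hc₁ + c₁ * hδ

theorem exists_specialLinearGroup_traces (p : Fin 6 → k) :
    ∃ A B C : SpecialLinearGroup (Fin 2) k,
      A.1.trace = p 0 ∧ B.1.trace = p 1 ∧ C.1.trace = p 2 ∧ (A.1 * B.1).trace = p 3 ∧
      (A.1 * C.1).trace = p 4 ∧ (B.1 * C.1).trace = p 5 := by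
  obtain ⟨a₁, a₂, a₃, a₄, b₁, b₂, b₃, b₄, c₁, c₂, c₃, c₄, ⟨hA, hB, hC⟩, h⟩ :=
    exists_matrix_entries (p 0) (p 1) (p 2) (p 3) (p 4) (p 5)
  refine ⟨⟨!![a₁, a₂; a₃, a₄], by rw [det_fin_two_of, hA]⟩,
    ⟨!![b₁, b₂; b₃, b₄], by rw [det_fin_two_of, hB]⟩,
    ⟨!![c₁, c₂; c₃, c₄], by rw [det_fin_two_of, hC]⟩, ?_⟩
  simpa [Matrix.trace_fin_two, Matrix.mul_apply, Fin.sum_univ_two] using h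

end Existence

/-! ### Reduction of words to ordered monomials -/

section TraceCombinations

variable {k : Type*} [Field k]

/-- The matrix of a representation of `F_3` at a word. -/
def repMatrix (ρ : FreeGroup (Fin 3) →* SpecialLinearGroup (Fin 2) k) (g : FreeGroup (Fin 3)) :
    Matrix (Fin 2) (Fin 2) k :=
  ρ g

section repMatrix

variable (ρ : FreeGroup (Fin 3) →* SpecialLinearGroup (Fin 2) k) (g h : FreeGroup (Fin 3))

theorem repCharacter_eq_trace : repCharacter ρ g = (repMatrix ρ g).trace := rfl

theorem det_repMatrix : (repMatrix ρ g).det = 1 := (ρ g).2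

theorem repMatrix_one : repMatrix ρ 1 = 1 := by
  rw [repMatrix, map_one]; rfl

theorem repMatrix_mul : repMatrix ρ (g * h) = repMatrix ρ g * repMatrix ρ h := by
  rw [repMatrix, map_mul]; rfl

theorem repMatrix_inv : repMatrix ρ g⁻¹ = (repMatrix ρ g).trace • 1 - repMatrix ρ g := by
  have h : repMatrix ρ g⁻¹ = (repMatrix ρ g).adjugate := by rw [repMatrix, map_inv]; rfl
  rw [h, Matrix.adjugate_fin_two]
  ext a b
  fin_cases a <;> fin_cases b <;> simp [Matrix.trace_fin_two]

end repMatrix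

/-- The traces of a representation of `F_3` at the six words. -/
def repTraces (ρ : FreeGroup (Fin 3) →* SpecialLinearGroup (Fin 2) k) : Fin 6 → k :=
  fun i => repCharacter ρ (sixWords i)

/-- The ordered monomials `1, A, B, C, AB, AC, BC, ABC` in the images of the generators. -/
def orderedMonomials (ρ : FreeGroup (Fin 3) →* SpecialLinearGroup (Fin 2) k) :
    Fin 8 → Matrix (Fin 2) (Fin 2) k :=
  let A := repMatrix ρ (FreeGroup.of 0)
  let B := repMatrix ρ (FreeGroup.of 1)
  let C := repMatrix ρ (FreeGroup.of 2)
  ![1, A, B, C, A * B, A * C, B * C, A * B * C]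

/-- Matrix-valued functions of a representation that are combinations of the ordered monomials
whose coefficients are universal polynomials in the six traces. -/
def IsTraceCombination
    (M : (FreeGroup (Fin 3) →* SpecialLinearGroup (Fin 2) k) → Matrix (Fin 2) (Fin 2) k) : Prop :=
  ∃ c : Fin 8 → MvPolynomial (Fin 6) k, ∀ ρ,
    M ρ = ∑ i, MvPolynomial.eval (repTraces ρ) (c i) • orderedMonomials ρ i

namespace IsTraceCombination

variable {M N : (FreeGroup (Fin 3) →* SpecialLinearGroup (Fin 2) k) → Matrix (Fin 2) (Fin 2) k}

theorem add (hM : IsTraceCombination M) (hN : IsTraceCombination N) :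
    IsTraceCombination (M + N) := by
  obtain ⟨c, hc⟩ := hM
  obtain ⟨d, hd⟩ := hN
  exact ⟨c + d, fun ρ => by
    simp only [Pi.add_apply, hc, hd, map_add, add_smul, Finset.sum_add_distrib]⟩

theorem smul (r : MvPolynomial (Fin 6) k) (hM : IsTraceCombination M) :
    IsTraceCombination (fun ρ => MvPolynomial.eval (repTraces ρ) r • M ρ) := by
  obtain ⟨c, hc⟩ := hM
  exact ⟨fun i => r * c i, fun ρ => by simp only [hc, map_mul, mul_smul, Finset.smul_sum]⟩

theorem zero : IsTraceCombination
    (0 : (FreeGroup (Fin 3) →* SpecialLinearGroup (Fin 2) k) → Matrix (Fin 2) (Fin 2) k) :=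
  ⟨0, fun ρ => by simp⟩

theorem mul_left {P : (FreeGroup (Fin 3) →* SpecialLinearGroup (Fin 2) k) →
      Matrix (Fin 2) (Fin 2) k}
    (hP : ∀ i, IsTraceCombination (fun ρ => P ρ * orderedMonomials ρ i))
    (hM : IsTraceCombination M) : IsTraceCombination (fun ρ => P ρ * M ρ) := by
  obtain ⟨c, hc⟩ := hM
  have : (fun ρ => P ρ * M ρ) = ∑ i, fun ρ =>
      MvPolynomial.eval (repTraces ρ) (c i) • (P ρ * orderedMonomials ρ i) := by
    funext ρ
    simp only [hc, Finset.mul_sum, Matrix.mul_smul, Finset.sum_apply]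
  rw [this]
  exact Finset.sum_induction _ _ (fun _ _ => add) zero fun i _ => (hP i).smul (c i)

end IsTraceCombination

/-- The matrices of left multiplication by the three generators on the ordered monomials. -/
def leftMulTable {R : Type*} [CommRing R] (x y z w v u : R) : Fin 3 → Fin 8 → Fin 8 → R := ![
    ![![0, 1, 0, 0, 0, 0, 0, 0], ![-1, x, 0, 0, 0, 0, 0, 0], ![0, 0, 0, 0, 1, 0, 0, 0],
      ![0, 0, 0, 0, 0, 1, 0, 0], ![0, 0, -1, 0, x, 0, 0, 0], ![0, 0, 0, -1, 0, x, 0, 0],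
      ![0, 0, 0, 0, 0, 0, 0, 1], ![0, 0, 0, 0, 0, 0, -1, x]],
    ![![0, 0, 1, 0, 0, 0, 0, 0], ![w - x * y, y, x, 0, -1, 0, 0, 0], ![-1, 0, y, 0, 0, 0, 0, 0],
      ![0, 0, 0, 0, 0, 0, 1, 0], ![-x, 1, w, 0, 0, 0, 0, 0],
      ![0, 0, 0, w - x * y, 0, y, x, -1], ![0, 0, 0, -1, 0, 0, y, 0],
      ![0, 0, 0, -x, 0, 1, w, 0]],
    ![![0, 0, 0, 1, 0, 0, 0, 0], ![v - x * z, z, 0, x, 0, -1, 0, 0],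
      ![u - y * z, 0, z, y, 0, 0, -1, 0], ![-1, 0, 0, z, 0, 0, 0, 0],
      ![x * (u - y * z), y * z - u, v, x * y, 0, -y, -x, 1], ![-x, 1, 0, v, 0, 0, 0, 0],
      ![-y, 0, 1, u, 0, 0, 0, 0], ![-x * y, y, x, x * u, -1, -u, v - x * z, z]]]

theorem map_leftMulTable {R S : Type*} [CommRing R] [CommRing S] (f : R →+* S)
    (x y z w v u : R) (j : Fin 3) (i l : Fin 8) :
    f (leftMulTable x y z w v u j i l) =
      leftMulTable (f x) (f y) (f z) (f w) (f v) (f u) j i l := by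
  fin_cases j <;> fin_cases i <;> fin_cases l <;> simp [leftMulTable]

-- Squares are lowered by Cayley–Hamilton and inversions removed by the swap rules, so the span of
-- the eight monomials is stable under left multiplication by each generator.
set_option maxHeartbeats 1000000 in
theorem mul_orderedMonomials (A B C : Matrix (Fin 2) (Fin 2) k) (x y z w v u : k)
    (hAA : A * A = x • A - 1) (hBB : B * B = y • B - 1) (hCC : C * C = z • C - 1)
    (hBA : B * A = -(A * B) + x • B + y • A + (w - x * y) • (1 : Matrix (Fin 2) (Fin 2) k))
    (hCA : C * A = -(A * C) + x • C + z • A + (v - x * z) • (1 : Matrix (Fin 2) (Fin 2) k))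
    (hCB : C * B = -(B * C) + y • C + z • B + (u - y * z) • (1 : Matrix (Fin 2) (Fin 2) k))
    (j : Fin 3) (i : Fin 8) :
    (![A, B, C] : Fin 3 → Matrix (Fin 2) (Fin 2) k) j *
      (![1, A, B, C, A * B, A * C, B * C, A * B * C] : Fin 8 → Matrix (Fin 2) (Fin 2) k) i =
    ∑ l, leftMulTable x y z w v u j i l •
      (![1, A, B, C, A * B, A * C, B * C, A * B * C] : Fin 8 → Matrix (Fin 2) (Fin 2) k) l := by
  -- The primed rules apply the relations at the head of a longer right-associated product.
  have hAA' (D) : A * (A * D) = x • (A * D) - D := by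
    rw [← mul_assoc, hAA, sub_mul, smul_mul_assoc, one_mul]
  have hBB' (D) : B * (B * D) = y • (B * D) - D := by
    rw [← mul_assoc, hBB, sub_mul, smul_mul_assoc, one_mul]
  have hBA' (D) : B * (A * D) = -(A * (B * D)) + x • (B * D) + y • (A * D)
      + (w - x * y) • D := by
    rw [← mul_assoc, hBA]; simp only [add_mul, neg_mul, smul_mul_assoc, one_mul, mul_assoc]
  have hCA' (D) : C * (A * D) = -(A * (C * D)) + x • (C * D) + z • (A * D)
      + (v - x * z) • D := by
    rw [← mul_assoc, hCA]; simp only [add_mul, neg_mul, smul_mul_assoc, one_mul, mul_assoc]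
  have hCB' (D) : C * (B * D) = -(B * (C * D)) + y • (C * D) + z • (B * D)
      + (u - y * z) • D := by
    rw [← mul_assoc, hCB]; simp only [add_mul, neg_mul, smul_mul_assoc, one_mul, mul_assoc]
  rw [Fin.sum_univ_eight]
  fin_cases j <;> fin_cases i <;>
    simp [leftMulTable, mul_assoc, hAA, hBB, hCC, hBA, hCA, hCB, hAA', hBB',
      hBA', hCA', hCB', mul_add, mul_sub] <;> module

open MvPolynomial in
theorem isTraceCombination_of_mul_orderedMonomials (j : Fin 3) (i : Fin 8) :
    IsTraceCombination (k := k) (fun ρ => repMatrix ρ (FreeGroup.of j) * orderedMonomials ρ i) := by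
  refine ⟨leftMulTable (X 0) (X 1) (X 2) (X 3) (X 4) (X 5) j i, fun ρ => ?_⟩
  have h := mul_orderedMonomials (repMatrix ρ (FreeGroup.of 0)) (repMatrix ρ (FreeGroup.of 1))
    (repMatrix ρ (FreeGroup.of 2)) _ _ _ _ _ _
    (mul_self_of_det_eq_one _ (det_repMatrix ρ _)) (mul_self_of_det_eq_one _ (det_repMatrix ρ _))
    (mul_self_of_det_eq_one _ (det_repMatrix ρ _)) (mul_comm_trace _ _) (mul_comm_trace _ _)
    (mul_comm_trace _ _) j i
  have hj : repMatrix ρ (FreeGroup.of j) = (![repMatrix ρ (FreeGroup.of 0),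
      repMatrix ρ (FreeGroup.of 1), repMatrix ρ (FreeGroup.of 2)] :
        Fin 3 → Matrix (Fin 2) (Fin 2) k) j := by
    fin_cases j <;> rfl
  have hM : orderedMonomials ρ = ![1, repMatrix ρ (FreeGroup.of 0), repMatrix ρ (FreeGroup.of 1),
      repMatrix ρ (FreeGroup.of 2), repMatrix ρ (FreeGroup.of 0) * repMatrix ρ (FreeGroup.of 1),
      repMatrix ρ (FreeGroup.of 0) * repMatrix ρ (FreeGroup.of 2),
      repMatrix ρ (FreeGroup.of 1) * repMatrix ρ (FreeGroup.of 2),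
      repMatrix ρ (FreeGroup.of 0) * repMatrix ρ (FreeGroup.of 1) *
        repMatrix ρ (FreeGroup.of 2)] := rfl
  simp only [← repMatrix_mul] at h hM
  simp only [map_leftMulTable, eval_X]
  rw [hj, hM]
  exact h

theorem isTraceCombination_mul (g : FreeGroup (Fin 3)) :
    ∀ {M : (FreeGroup (Fin 3) →* SpecialLinearGroup (Fin 2) k) → Matrix (Fin 2) (Fin 2) k},
      IsTraceCombination M → IsTraceCombination (fun ρ => repMatrix ρ g * M ρ) := by
  induction g using FreeGroup.induction_on with
  | C1 => intro M hM; simpa [repMatrix_one] using hM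
  | of j =>
    intro M hM
    exact hM.mul_left (isTraceCombination_of_mul_orderedMonomials j)
  | inv_of j ih =>
    intro M hM
    -- In `SL₂`, `g⁻¹ = tr(g) - g`; the first three of the six coordinates are the traces of the
    -- generators.
    have h1 := (hM.smul (MvPolynomial.X (Fin.castLE (by decide) j))).add ((ih hM).smul (-1))
    convert h1 using 1
    funext ρ
    have htr : MvPolynomial.eval (repTraces ρ) (MvPolynomial.X (Fin.castLE (by decide) j)) =
        (repMatrix ρ (FreeGroup.of j)).trace := by
      fin_cases j <;> simp [repTraces, repCharacter_eq_trace, sixWords]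
    rw [Pi.add_apply, htr, repMatrix_inv, sub_mul, smul_mul_assoc, one_mul]
    simp [sub_eq_add_neg]
  | mul g h ihg ihh =>
    intro M hM
    simpa [repMatrix_mul, mul_assoc] using ihg (ihh hM)

theorem isTraceCombination_apply (g : FreeGroup (Fin 3)) :
    IsTraceCombination (k := k) (fun ρ => repMatrix ρ g) := by
  have h : IsTraceCombination (k := k) (fun _ => 1) :=
    ⟨![1, 0, 0, 0, 0, 0, 0, 0], fun ρ => by simp [Fin.sum_univ_eight, orderedMonomials]⟩
  simpa using isTraceCombination_mul g h

/-- The word `ABC`. -/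
def tripleWord : FreeGroup (Fin 3) := FreeGroup.of 0 * FreeGroup.of 1 * FreeGroup.of 2

open MvPolynomial in
/-- Every trace function is a combination of `1` and `t_ABC` with universal polynomials in the
six traces as coefficients. -/
theorem exists_repCharacter_eq (g : FreeGroup (Fin 3)) :
    ∃ a b : MvPolynomial (Fin 6) k,
      ∀ ρ : FreeGroup (Fin 3) →* SpecialLinearGroup (Fin 2) k,
        repCharacter ρ g = eval (repTraces ρ) a + eval (repTraces ρ) b * repCharacter ρ tripleWord := by
  obtain ⟨c, hc⟩ := isTraceCombination_apply (k := k) g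
  -- The constant 2 is the trace of the identity.
  refine ⟨c 0 * 2 + c 1 * X 0 + c 2 * X 1 + c 3 * X 2 + c 4 * X 3 + c 5 * X 4 + c 6 * X 5, c 7,
    fun ρ => ?_⟩
  rw [repCharacter_eq_trace, show repMatrix ρ g = _ from hc ρ]
  simp [Fin.sum_univ_eight, orderedMonomials, Matrix.trace_add, Matrix.trace_smul, repTraces,
    repCharacter_eq_trace, repMatrix_mul, sixWords, tripleWord, Matrix.trace_one]

end TraceCombinations

/-! ### The character variety as a hypersurface -/

section CoordRing

variable {k : Type*} [Field k]

/-- Evaluation of the ring of functions at a point of the character variety. -/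
def evalAt (χ : CharacterVariety (FreeGroup (Fin 3)) 2 k) :
    characterCoordRing (FreeGroup (Fin 3)) 2 k →ₐ[k] k :=
  (Pi.evalAlgHom k _ χ).comp (characterCoordRing (FreeGroup (Fin 3)) 2 k).val

theorem evalAt_apply (χ : CharacterVariety (FreeGroup (Fin 3)) 2 k)
    (h : characterCoordRing (FreeGroup (Fin 3)) 2 k) : evalAt χ h = h.1 χ := rfl

theorem evalAt_traceFn (χ : CharacterVariety (FreeGroup (Fin 3)) 2 k) (g : FreeGroup (Fin 3)) :
    evalAt χ (traceFn 2 k g) = χ.1 g := rfl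

/-- The point of the character variety given by a representation. -/
def characterOf (ρ : FreeGroup (Fin 3) →* SpecialLinearGroup (Fin 2) k) :
    CharacterVariety (FreeGroup (Fin 3)) 2 k := ⟨repCharacter ρ, ρ, rfl⟩

theorem exists_eq_characterOf (χ : CharacterVariety (FreeGroup (Fin 3)) 2 k) :
    ∃ ρ, χ = characterOf ρ := by
  obtain ⟨_, ρ, rfl⟩ := χ
  exact ⟨ρ, rfl⟩

theorem evalAt_characterOf (ρ : FreeGroup (Fin 3) →* SpecialLinearGroup (Fin 2) k)
    (g : FreeGroup (Fin 3)) :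
    evalAt (characterOf ρ) (traceFn 2 k g) = (repMatrix ρ g).trace := rfl

theorem sixTraceMap_characterOf (ρ : FreeGroup (Fin 3) →* SpecialLinearGroup (Fin 2) k)
    (i : Fin 6) : sixTraceMap k (characterOf ρ) i = (repMatrix ρ (sixWords i)).trace := rfl

theorem coordRing_ext {h h' : characterCoordRing (FreeGroup (Fin 3)) 2 k}
    (H : ∀ χ, evalAt χ h = evalAt χ h') : h = h' :=
  Subtype.ext (funext H)

theorem evalAt_aeval (χ : CharacterVariety (FreeGroup (Fin 3)) 2 k)
    (a : MvPolynomial (Fin 6) k) :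
    evalAt χ (MvPolynomial.aeval (sixTraces k) a) = MvPolynomial.eval (sixTraceMap k χ) a := by
  rw [← AlgHom.comp_apply, MvPolynomial.comp_aeval, ← MvPolynomial.coe_aeval_eq_eval]
  rfl

variable (k) in
/-- The trace function `t_ABC`. -/
def tripleTrace : characterCoordRing (FreeGroup (Fin 3)) 2 k := traceFn 2 k tripleWord

open MvPolynomial in
variable (k) in
/-- The coefficient `X` of the quadratic equation of `t_ABC`. -/
noncomputable def quadraticX : MvPolynomial (Fin 6) k :=
  X 3 * X 2 + X 4 * X 1 + X 5 * X 0 - X 0 * X 1 * X 2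

open MvPolynomial in
variable (k) in
/-- The coefficient `Y` of the quadratic equation of `t_ABC`. -/
noncomputable def quadraticY : MvPolynomial (Fin 6) k :=
  -X 0 ^ 2 - X 1 ^ 2 - X 2 ^ 2 + X 5 * X 1 * X 2 + X 4 * X 0 * X 2 + X 3 * X 0 * X 1
    - X 5 * X 4 * X 3 - X 5 ^ 2 - X 4 ^ 2 - X 3 ^ 2 + 4

open MvPolynomial in
theorem branchDiscr_eq (p : Fin 6 → k) :
    branchDiscr p = eval p (quadraticX k) ^ 2 + 4 * eval p (quadraticY k) := by
  simp [branchDiscr, quadraticX, quadraticY]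

open MvPolynomial in
theorem evalAt_tripleTrace_sq (χ : CharacterVariety (FreeGroup (Fin 3)) 2 k) :
    evalAt χ (tripleTrace k) ^ 2 =
      eval (sixTraceMap k χ) (quadraticX k) * evalAt χ (tripleTrace k)
        + eval (sixTraceMap k χ) (quadraticY k) := by
  obtain ⟨ρ, rfl⟩ := exists_eq_characterOf χ
  have h := trace_mul_mul_sq _ _ _ (det_repMatrix ρ (FreeGroup.of 0))
    (det_repMatrix ρ (FreeGroup.of 1)) (det_repMatrix ρ (FreeGroup.of 2))
  simp only [← repMatrix_mul] at h
  simpa [quadraticX, quadraticY, sixTraceMap_characterOf, sixWords, tripleTrace,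
    evalAt_characterOf, tripleWord] using h

open MvPolynomial in
theorem tripleTrace_sq :
    tripleTrace k ^ 2 = aeval (sixTraces k) (quadraticX k) * tripleTrace k
      + aeval (sixTraces k) (quadraticY k) :=
  coordRing_ext fun χ => by
    simp only [map_pow, map_add, map_mul, evalAt_aeval, evalAt_tripleTrace_sq]

open MvPolynomial in
theorem exists_traceFn_eq (g : FreeGroup (Fin 3)) : ∃ a b : MvPolynomial (Fin 6) k,
    traceFn 2 k g = aeval (sixTraces k) a + aeval (sixTraces k) b * tripleTrace k := by
  obtain ⟨a, b, h⟩ := exists_repCharacter_eq (k := k) g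
  refine ⟨a, b, coordRing_ext fun χ => ?_⟩
  simp only [map_add, map_mul, evalAt_aeval]
  obtain ⟨ρ, rfl⟩ := exists_eq_characterOf χ
  exact h ρ

open MvPolynomial in
/-- The ring of functions is spanned by `1` and `t_ABC` over the polynomials in the six traces. -/
theorem exists_eq_add_mul_tripleTrace (h : characterCoordRing (FreeGroup (Fin 3)) 2 k) :
    ∃ a b : MvPolynomial (Fin 6) k,
      h = aeval (sixTraces k) a + aeval (sixTraces k) b * tripleTrace k := by
  obtain ⟨f, hf⟩ := h
  induction hf using Algebra.adjoin_induction with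
  | mem x hx =>
    obtain ⟨g, rfl⟩ := hx
    exact exists_traceFn_eq g
  | algebraMap r => exact ⟨C r, 0, by rw [map_zero, zero_mul, add_zero, aeval_C]; rfl⟩
  | add x y hx hy ihx ihy =>
    obtain ⟨a, b, h1⟩ := ihx
    obtain ⟨c, d, h2⟩ := ihy
    refine ⟨a + c, b + d, ?_⟩
    rw [map_add, map_add, add_mul, add_add_add_comm, ← h1, ← h2]
    rfl
  | mul x y hx hy ihx ihy =>
    obtain ⟨a, b, h1⟩ := ihx
    obtain ⟨c, d, h2⟩ := ihy
    refine ⟨a * c + b * d * quadraticY k, a * d + b * c + b * d * quadraticX k, ?_⟩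
    have h3 : (⟨x * y, mul_mem hx hy⟩ : characterCoordRing (FreeGroup (Fin 3)) 2 k) =
      ⟨x, hx⟩ * ⟨y, hy⟩ := rfl
    rw [h3, h1, h2]
    simp only [map_add, map_mul]
    linear_combination aeval (sixTraces k) b * aeval (sixTraces k) d * tripleTrace_sq (k := k)

theorem characterVariety_ext {χ χ' : CharacterVariety (FreeGroup (Fin 3)) 2 k}
    (h : sixTraceMap k χ = sixTraceMap k χ')
    (ht : evalAt χ (tripleTrace k) = evalAt χ' (tripleTrace k)) : χ = χ' := by
  refine Subtype.ext (funext fun g => ?_)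
  obtain ⟨a, b, hg⟩ := exists_traceFn_eq (k := k) g
  rw [← evalAt_traceFn, ← evalAt_traceFn, hg]
  simp only [map_add, map_mul, evalAt_aeval, h, ht]

open MvPolynomial in
/-- The characters are all the points of the hypersurface `t² = X t + Y`. -/
theorem exists_character [IsAlgClosed k] (p : Fin 6 → k) (t : k)
    (ht : t ^ 2 = eval p (quadraticX k) * t + eval p (quadraticY k)) :
    ∃ χ, sixTraceMap k χ = p ∧ evalAt χ (tripleTrace k) = t := by
  obtain ⟨A, B, C, h0, h1, h2, h3, h4, h5⟩ := exists_specialLinearGroup_traces p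
  let ρ : FreeGroup (Fin 3) →* SpecialLinearGroup (Fin 2) k := FreeGroup.lift ![A, B, C]
  -- Transposing the generators keeps the six traces but replaces `tr ABC` by `tr CBA`. The two sum
  -- to `X`, so they are the two roots of the quadratic, and `t` is one of them.
  let τ : FreeGroup (Fin 3) →* SpecialLinearGroup (Fin 2) k :=
    FreeGroup.lift ![A.transpose, B.transpose, C.transpose]
  have ρ0 : repMatrix ρ (FreeGroup.of 0) = A.1 := by simp [repMatrix, ρ]
  have ρ1 : repMatrix ρ (FreeGroup.of 1) = B.1 := by simp [repMatrix, ρ]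
  have ρ2 : repMatrix ρ (FreeGroup.of 2) = C.1 := by simp [repMatrix, ρ]
  have τ0 : repMatrix τ (FreeGroup.of 0) = A.1ᵀ := by simp [repMatrix, τ]
  have τ1 : repMatrix τ (FreeGroup.of 1) = B.1ᵀ := by simp [repMatrix, τ]
  have τ2 : repMatrix τ (FreeGroup.of 2) = C.1ᵀ := by simp [repMatrix, τ]
  have hρ : sixTraceMap k (characterOf ρ) = p := by
    funext i
    fin_cases i <;> simp [sixTraceMap_characterOf, sixWords,
      repMatrix_mul, ρ0, ρ1, ρ2, h0, h1, h2, h3, h4, h5]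
  have hτ : sixTraceMap k (characterOf τ) = p := by
    funext i
    fin_cases i <;> simp [sixTraceMap_characterOf, sixWords,
      repMatrix_mul, τ0, τ1, τ2, ← Matrix.transpose_mul, Matrix.trace_transpose,
      Matrix.trace_mul_comm B.1 A.1, Matrix.trace_mul_comm C.1 A.1, Matrix.trace_mul_comm C.1 B.1,
      h0, h1, h2, h3, h4, h5]
  have tρ : evalAt (characterOf ρ) (tripleTrace k) = (A.1 * B.1 * C.1).trace := by
    rw [tripleTrace, evalAt_characterOf, tripleWord, repMatrix_mul,
      repMatrix_mul, ρ0, ρ1, ρ2]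
  have tτ : evalAt (characterOf τ) (tripleTrace k) = (C.1 * B.1 * A.1).trace := by
    rw [tripleTrace, evalAt_characterOf, tripleWord, repMatrix_mul,
      repMatrix_mul, τ0, τ1, τ2, ← Matrix.transpose_mul, ← Matrix.transpose_mul,
      Matrix.trace_transpose, mul_assoc]
  have hsum := trace_mul_mul_add_trace_mul_mul A.1 B.1 C.1
  rw [← tρ, ← tτ, h0, h1, h2, h3, h4, h5] at hsum
  have hX : eval p (quadraticX k) = evalAt (characterOf ρ) (tripleTrace k)
      + evalAt (characterOf τ) (tripleTrace k) := by
    rw [hsum]; simp [quadraticX]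
  have hsq := evalAt_tripleTrace_sq (k := k) (characterOf ρ)
  rw [hρ] at hsq
  have hfac : (t - evalAt (characterOf ρ) (tripleTrace k)) *
      (t - evalAt (characterOf τ) (tripleTrace k)) = 0 := by
    linear_combination ht - hsq + (t - evalAt (characterOf ρ) (tripleTrace k)) * hX
  rcases mul_eq_zero.1 hfac with h | h
  · exact ⟨_, hρ, (sub_eq_zero.1 h).symm⟩
  · exact ⟨_, hτ, (sub_eq_zero.1 h).symm⟩

/-! ### The discriminant and irreducibility of the quadratic -/

theorem branchDiscr_line (s c : k) :
    branchDiscr ![s, 0, 0, 0, 0, c] = (c ^ 2 - 4) * (s ^ 2 - 4) := by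
  simp [branchDiscr]; ring

-- The values at `c = 0` and `c = 1` differ by 1, so they cannot both vanish, whatever the
-- characteristic.
variable (k) in
theorem exists_sq_ne_four : ∃ c : k, c ^ 2 - 4 ≠ 0 := by
  by_contra! h
  have h0 := h 0
  have h1 := h 1
  exact one_ne_zero (α := k) (by linear_combination h1 - h0)

variable (k) in
theorem exists_branchDiscr_ne_zero : ∃ p : Fin 6 → k, branchDiscr p ≠ 0 := by
  obtain ⟨c, hc⟩ := exists_sq_ne_four k
  exact ⟨_, by rw [branchDiscr_line c c]; exact mul_ne_zero hc hc⟩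

variable (k) in
theorem exists_branchDiscr_eq_zero : ∃ p : Fin 6 → k, branchDiscr p = 0 :=
  ⟨_, by rw [branchDiscr_line 2 0]; norm_num⟩

theorem eq_zero_of_quadratic_eq_zero {l m n : k} (h : Polynomial.C l * Polynomial.X ^ 2 +
    Polynomial.C m * Polynomial.X + Polynomial.C n = 0) : l = 0 ∧ m = 0 ∧ n = 0 := by
  have h0 := congrArg (fun q => Polynomial.coeff q 0) h
  have h1 := congrArg (fun q => Polynomial.coeff q 1) h
  have h2 := congrArg (fun q => Polynomial.coeff q 2) h
  simp [Polynomial.coeff_X, Polynomial.coeff_C, Polynomial.coeff_X_pow] at h0 h1 h2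
  exact ⟨h2, h1, h0⟩

-- Here `-r` would be a root of `t² = X t + Y`. Restricting to the line where `x` varies, `u = c`
-- with `c² ≠ 4`, and the other coordinates vanish leaves a one-variable equation, excluded by
-- degree and by comparing coefficients.
open MvPolynomial in
theorem quadratic_ne_zero (r : MvPolynomial (Fin 6) k) :
    r ^ 2 + quadraticX k * r - quadraticY k ≠ 0 := by
  intro h
  obtain ⟨c, hc⟩ := exists_sq_ne_four k
  let φ : MvPolynomial (Fin 6) k →ₐ[k] Polynomial k :=
    aeval ![Polynomial.X, 0, 0, 0, 0, Polynomial.C c]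
  have h' := congrArg φ h
  have hX : φ (quadraticX k) = Polynomial.C c * Polynomial.X := by simp [φ, quadraticX]
  have hY : φ (quadraticY k) = -Polynomial.X ^ 2 + Polynomial.C (4 - c ^ 2) := by
    have h4 : (Polynomial.C 4 : Polynomial k) = 4 := map_ofNat Polynomial.C 4
    simp [φ, quadraticY, h4]; ring
  rw [map_sub, map_add, map_pow, map_mul, map_zero, hX, hY] at h'
  generalize φ r = f at h'
  -- If `deg f ≥ 2`, then `f (f + cX)` has degree `2 deg f ≥ 4`, while the other side has degree at
  -- most 2.
  have hdeg : f.natDegree ≤ 1 := by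
    by_contra! hf
    have hf0 : f ≠ 0 := by rintro rfl; simp at hf
    have e : f * (f + Polynomial.C c * Polynomial.X) =
        -Polynomial.X ^ 2 + Polynomial.C (4 - c ^ 2) := by linear_combination h'
    have hcX : (Polynomial.C c * Polynomial.X : Polynomial k).natDegree < f.natDegree :=
      lt_of_le_of_lt (by compute_degree) hf
    have d1 : (f + Polynomial.C c * Polynomial.X).natDegree = f.natDegree :=
      Polynomial.natDegree_add_eq_left_of_natDegree_lt hcX
    have hg0 : f + Polynomial.C c * Polynomial.X ≠ 0 := by
      intro h0; rw [h0] at d1; simp at d1; omega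
    have d2 := congrArg Polynomial.natDegree e
    rw [Polynomial.natDegree_mul hf0 hg0, d1] at d2
    have d3 : (-Polynomial.X ^ 2 + Polynomial.C (4 - c ^ 2) : Polynomial k).natDegree ≤ 2 := by
      compute_degree
    omega
  obtain ⟨α, β, rfl⟩ := Polynomial.exists_eq_X_add_C_of_natDegree_le_one hdeg
  have e : (Polynomial.C α * Polynomial.X + Polynomial.C β) ^ 2 + Polynomial.C c * Polynomial.X *
      (Polynomial.C α * Polynomial.X + Polynomial.C β)
        - (-Polynomial.X ^ 2 + Polynomial.C (4 - c ^ 2)) =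
      Polynomial.C (α ^ 2 + c * α + 1) * Polynomial.X ^ 2 +
        Polynomial.C (2 * α * β + c * β) * Polynomial.X + Polynomial.C (β ^ 2 - (4 - c ^ 2)) := by
    simp only [map_add, map_mul, map_sub, map_pow, map_one, map_ofNat]; ring
  rw [e] at h'
  obtain ⟨c2, c1, c0⟩ := eq_zero_of_quadratic_eq_zero h'
  have hβ : β ≠ 0 := by
    rintro rfl
    apply hc
    linear_combination c0
  have hα : 2 * α + c = 0 := by
    have : β * (2 * α + c) = 0 := by linear_combination c1
    exact (mul_eq_zero.1 this).resolve_left hβ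
  apply hc
  -- `c² - 4` is the discriminant of `α² + cα + 1`, hence equals `(2α + c)² = 0`.
  linear_combination (2 * α + c) * hα - 4 * c2

/-! ### Fibres of the cover and independence of `1` and `t_ABC` -/

variable [IsAlgClosed k]

open MvPolynomial in
/-- The fibres of the double cover. -/
theorem exists_fibre_eq_pair (p : Fin 6 → k) : ∃ χ χ' : CharacterVariety (FreeGroup (Fin 3)) 2 k,
    sixTraceMap k ⁻¹' {p} = {χ, χ'} ∧
      branchDiscr p = (evalAt χ (tripleTrace k) - evalAt χ' (tripleTrace k)) ^ 2 := by
  obtain ⟨t, ht⟩ := exists_quadratic_root (one_ne_zero (α := k)) (-eval p (quadraticX k))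
    (-eval p (quadraticY k))
  -- The roots are `t` and `X - t`, and `Δ = (2t - X)²` is the square of their difference.
  obtain ⟨χ, h1, h2⟩ := exists_character p t (by linear_combination ht)
  obtain ⟨χ', h1', h2'⟩ := exists_character p (eval p (quadraticX k) - t)
    (by linear_combination ht)
  refine ⟨χ, χ', Set.ext fun ψ => ⟨fun hψ => ?_, ?_⟩, ?_⟩
  · have hψ' : sixTraceMap k ψ = p := hψ
    have hsq := evalAt_tripleTrace_sq ψ
    rw [hψ'] at hsq
    have hfac : (evalAt ψ (tripleTrace k) - t) *
        (evalAt ψ (tripleTrace k) - (eval p (quadraticX k) - t)) = 0 := by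
      linear_combination hsq - ht
    rcases mul_eq_zero.1 hfac with h | h
    · exact Or.inl (characterVariety_ext (hψ'.trans h1.symm) ((sub_eq_zero.1 h).trans h2.symm))
    · exact Or.inr (characterVariety_ext (hψ'.trans h1'.symm) ((sub_eq_zero.1 h).trans h2'.symm))
  · rintro (rfl | rfl)
    exacts [h1, h1']
  · rw [h2, h2', branchDiscr_eq]
    linear_combination -4 * ht

theorem sixTraceMap_surjective : Function.Surjective (sixTraceMap k) := fun p => by
  obtain ⟨χ, χ', h, -⟩ := exists_fibre_eq_pair p
  have : χ ∈ sixTraceMap k ⁻¹' {p} := h ▸ Or.inl rfl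
  exact ⟨χ, this⟩

theorem encard_fibre_of_ne_zero (p : Fin 6 → k) (hp : branchDiscr p ≠ 0) :
    (sixTraceMap k ⁻¹' {p}).encard = 2 := by
  obtain ⟨χ, χ', h, hd⟩ := exists_fibre_eq_pair p
  rw [h, Set.encard_pair]
  rintro rfl
  simp [hd] at hp

theorem encard_fibre_of_eq_zero (p : Fin 6 → k) (hp : branchDiscr p = 0) :
    (sixTraceMap k ⁻¹' {p}).encard = 1 := by
  obtain ⟨χ, χ', h, hd⟩ := exists_fibre_eq_pair p
  have hχ : χ ∈ sixTraceMap k ⁻¹' {p} := h ▸ Or.inl rfl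
  have hχ' : χ' ∈ sixTraceMap k ⁻¹' {p} := h ▸ Or.inr rfl
  have : χ = χ' := characterVariety_ext (Eq.trans hχ (Eq.symm hχ'))
    (sub_eq_zero.1 (pow_eq_zero_iff two_ne_zero |>.1 (hd.symm.trans hp)))
  rw [h, this, Set.pair_eq_singleton, Set.encard_singleton]

-- Subtracting the relation at the two points over `p` gives `b(p)(t - t') = 0`, hence `bΔ = 0` at
-- every point. Since `k` is infinite this holds for polynomials, and `Δ ≠ 0` forces `b = 0`.
open MvPolynomial in
theorem eq_zero_of_aeval_add_mul_eq_zero {a b : MvPolynomial (Fin 6) k}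
    (h : aeval (sixTraces k) a + aeval (sixTraces k) b * tripleTrace k = 0) :
    a = 0 ∧ b = 0 := by
  have heval (χ) : eval (sixTraceMap k χ) a
      + eval (sixTraceMap k χ) b * evalAt χ (tripleTrace k) = 0 := by
    simpa only [map_add, map_mul, evalAt_aeval, map_zero] using congrArg (evalAt χ) h
  have hb : b = 0 := by
    have hmul : b * (quadraticX k ^ 2 + 4 * quadraticY k) = 0 := by
      refine MvPolynomial.funext fun p => ?_
      obtain ⟨χ, χ', hf, hd⟩ := exists_fibre_eq_pair p
      have hχ : sixTraceMap k χ = p := show χ ∈ sixTraceMap k ⁻¹' {p} from hf ▸ Or.inl rfl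
      have hχ' : sixTraceMap k χ' = p := show χ' ∈ sixTraceMap k ⁻¹' {p} from hf ▸ Or.inr rfl
      have e := heval χ
      have e' := heval χ'
      rw [hχ] at e
      rw [hχ'] at e'
      have hD : eval p (quadraticX k ^ 2 + 4 * quadraticY k) = branchDiscr p := by
        rw [branchDiscr_eq]; simp
      rw [map_mul, hD, hd, map_zero]
      linear_combination (evalAt χ (tripleTrace k) - evalAt χ' (tripleTrace k)) * (e - e')
    refine (mul_eq_zero.1 hmul).resolve_right fun hD => ?_
    obtain ⟨p, hp⟩ := exists_branchDiscr_ne_zero k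
    apply hp
    rw [branchDiscr_eq]
    simpa using congrArg (eval p) hD
  refine ⟨MvPolynomial.funext fun p => ?_, hb⟩
  obtain ⟨χ, rfl⟩ := sixTraceMap_surjective p
  simpa [hb] using heval χ

end CoordRing

/-! ### Integral domain, free basis and points of the ring -/

section CoordRing

variable {k : Type*} [Field k]

theorem div_root_of_norm_eq_zero {K : Type*} [Field K] {a b x y : K} (hb : b ≠ 0)
    (h : a ^ 2 + a * b * x - b ^ 2 * y = 0) : (a / b) ^ 2 + x * (a / b) - y = 0 := by
  field_simp
  linear_combination h

open MvPolynomial in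
/-- The norm form of the quadratic extension defined by `t² = X t + Y` is anisotropic. -/
theorem eq_zero_of_norm_eq_zero {a b : MvPolynomial (Fin 6) k}
    (h : a ^ 2 + a * b * quadraticX k - b ^ 2 * quadraticY k = 0) : a = 0 ∧ b = 0 := by
  have hb : b = 0 := by
    by_contra hb
    let K := FractionRing (MvPolynomial (Fin 6) k)
    let ι : MvPolynomial (Fin 6) k →+* K := algebraMap _ K
    have hι : Function.Injective ι := IsFractionRing.injective _ K
    have hb' : ι b ≠ 0 := (map_ne_zero_iff ι hι).2 hb
    have hK : (ι a / ι b) ^ 2 + ι (quadraticX k) * (ι a / ι b) - ι (quadraticY k) = 0 := by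
      refine div_root_of_norm_eq_zero hb' ?_
      simpa only [map_sub, map_add, map_mul, map_pow, map_zero] using congrArg ι h
    -- The polynomial ring is integrally closed, so this root `a/b` of a monic quadratic would be a
    -- polynomial, against `quadratic_ne_zero`.
    have hint : IsIntegral (MvPolynomial (Fin 6) k) (ι a / ι b) := by
      refine ⟨Polynomial.X ^ 2 + Polynomial.C (quadraticX k) * Polynomial.X
        - Polynomial.C (quadraticY k), by monicity!, ?_⟩
      simpa using hK
    obtain ⟨r, hr⟩ := IsIntegrallyClosed.isIntegral_iff.1 hint
    refine quadratic_ne_zero r (hι ?_)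
    have hr' : ι r = ι a / ι b := hr
    simp only [map_sub, map_add, map_mul, map_pow, map_zero, hr', hK]
  subst hb
  exact ⟨by simpa using h, rfl⟩

variable [IsAlgClosed k]

open MvPolynomial in
theorem isDomain_characterCoordRing : IsDomain (characterCoordRing (FreeGroup (Fin 3)) 2 k) := by
  have hnontriv : Nontrivial (characterCoordRing (FreeGroup (Fin 3)) 2 k) := by
    obtain ⟨χ, -⟩ := sixTraceMap_surjective (k := k) 0
    exact (evalAt χ).toRingHom.domain_nontrivial
  have hnzd : NoZeroDivisors (characterCoordRing (FreeGroup (Fin 3)) 2 k) := by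
    refine ⟨fun {f g} hfg => ?_⟩
    obtain ⟨a, b, rfl⟩ := exists_eq_add_mul_tripleTrace f
    obtain ⟨c, d, rfl⟩ := exists_eq_add_mul_tripleTrace g
    have hT := tripleTrace_sq (k := k)
    obtain ⟨h1, h2⟩ := eq_zero_of_aeval_add_mul_eq_zero
      (a := a * c + b * d * quadraticY k) (b := a * d + b * c + b * d * quadraticX k) (by
        simp only [map_add, map_mul]
        linear_combination hfg - aeval (sixTraces k) b * aeval (sixTraces k) d * hT)
    -- Multiplicativity of the norm `N(a + bt) = (a + bt)(a + b(X - t))`, applied to a zero product.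
    have hN : (a ^ 2 + a * b * quadraticX k - b ^ 2 * quadraticY k) *
        (c ^ 2 + c * d * quadraticX k - d ^ 2 * quadraticY k) = 0 := by
      linear_combination (a * c + b * d * quadraticY k) * h1
        + (a * c + b * d * quadraticY k) * quadraticX k * h2
        - (a * d + b * c + b * d * quadraticX k) * quadraticY k * h2
    rcases mul_eq_zero.1 hN with h | h
    · obtain ⟨rfl, rfl⟩ := eq_zero_of_norm_eq_zero h
      exact Or.inl (by simp)
    · obtain ⟨rfl, rfl⟩ := eq_zero_of_norm_eq_zero h
      exact Or.inr (by simp)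
  exact NoZeroDivisors.to_isDomain _

theorem algebraicIndependent_sixTraces : AlgebraicIndependent k (sixTraces k) := by
  rw [algebraicIndependent_iff_injective_aeval, injective_iff_map_eq_zero]
  intro a ha
  exact (eq_zero_of_aeval_add_mul_eq_zero (b := 0) (by simpa using ha)).1

omit [IsAlgClosed k] in
theorem exists_aeval_eq (s : sixTraceSubring k) :
    ∃ a : MvPolynomial (Fin 6) k, MvPolynomial.aeval (sixTraces k) a = s.1 := by
  have h : s.1 ∈ Algebra.adjoin k (Set.range (sixTraces k)) := s.2
  rw [Algebra.adjoin_range_eq_range_aeval] at h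
  exact h

omit [IsAlgClosed k] in
theorem aeval_mem_sixTraceSubring (a : MvPolynomial (Fin 6) k) :
    MvPolynomial.aeval (sixTraces k) a ∈ sixTraceSubring k := by
  rw [sixTraceSubring, Algebra.adjoin_range_eq_range_aeval]
  exact ⟨a, rfl⟩

variable (k) in
/-- `1` and `t_ABC` form a basis of the ring of functions over the six traces. -/
noncomputable def coordRingBasis : Module.Basis (Fin 2) (sixTraceSubring k)
    (characterCoordRing (FreeGroup (Fin 3)) 2 k) :=
  Module.Basis.mk (v := ![1, tripleTrace k])
    (by
      refine (LinearIndependent.pair_iff (R := sixTraceSubring k)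
        (M := characterCoordRing (FreeGroup (Fin 3)) 2 k)).2 fun s t h => ?_
      obtain ⟨a, ha⟩ := exists_aeval_eq s
      obtain ⟨b, hb⟩ := exists_aeval_eq t
      obtain ⟨rfl, rfl⟩ := eq_zero_of_aeval_add_mul_eq_zero (a := a) (b := b) (by
        rw [ha, hb, ← h, Algebra.smul_def, Algebra.smul_def, mul_one]; rfl)
      exact ⟨Subtype.ext (by rw [← ha, map_zero]; rfl), Subtype.ext (by rw [← hb, map_zero]; rfl)⟩)
    (by
      intro h _
      obtain ⟨a, b, rfl⟩ := exists_eq_add_mul_tripleTrace h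
      rw [Matrix.range_cons, Matrix.range_cons, Matrix.range_empty, Set.union_empty,
        Set.singleton_union, Submodule.mem_span_pair]
      refine ⟨⟨_, aeval_mem_sixTraceSubring a⟩, ⟨_, aeval_mem_sixTraceSubring b⟩, ?_⟩
      rw [Algebra.smul_def, Algebra.smul_def, mul_one]; rfl)

variable (k) in
theorem finite_characterCoordRing :
    Module.Finite (sixTraceSubring k) (characterCoordRing (FreeGroup (Fin 3)) 2 k) :=
  Module.Finite.of_basis (coordRingBasis k)

variable (k) in
theorem fg_characterCoordRing : (characterCoordRing (FreeGroup (Fin 3)) 2 k).FG := by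
  rw [Subalgebra.fg_iff_finiteType]
  have := finite_characterCoordRing k
  have : Algebra.FiniteType k (sixTraceSubring k) :=
    (Subalgebra.fg_iff_finiteType _).1
      ⟨(Set.finite_range (sixTraces k)).toFinset, by rw [Set.Finite.coe_toFinset]; rfl⟩
  exact Algebra.FiniteType.trans (S := sixTraceSubring k) inferInstance inferInstance

variable (k) in
theorem isTranscendenceBasis_sixTraces : IsTranscendenceBasis k (sixTraces k) := by
  have := isDomain_characterCoordRing (k := k)
  have := finite_characterCoordRing k
  rw [algebraicIndependent_sixTraces.isTranscendenceBasis_iff_isAlgebraic]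
  have hint : Algebra.IsIntegral (sixTraceSubring k)
      (characterCoordRing (FreeGroup (Fin 3)) 2 k) := Algebra.IsIntegral.of_finite _ _
  have hnt : Nontrivial (sixTraceSubring k) := inferInstance
  exact Algebra.IsIntegral.isAlgebraic (R := sixTraceSubring k)
    (A := characterCoordRing (FreeGroup (Fin 3)) 2 k)

variable (k) in
theorem finrank_characterCoordRing :
    Module.finrank (sixTraceSubring k) (characterCoordRing (FreeGroup (Fin 3)) 2 k) = 2 := by
  have := isDomain_characterCoordRing (k := k)
  have : Nontrivial (sixTraceSubring k) := inferInstance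
  have : StrongRankCondition (sixTraceSubring k) :=
    @commRing_strongRankCondition (sixTraceSubring k) inferInstance _
  rw [Module.finrank_eq_card_basis (coordRingBasis k), Fintype.card_fin]

-- A homomorphism is determined by its values on the six traces and `t_ABC`. These satisfy the
-- quadratic, so they are the coordinates of a character.
open MvPolynomial in
theorem existsUnique_point (f : characterCoordRing (FreeGroup (Fin 3)) 2 k →ₐ[k] k) :
    ∃! χ : CharacterVariety (FreeGroup (Fin 3)) 2 k, ∀ h, f h = h.1 χ := by
  have hf (a : MvPolynomial (Fin 6) k) :
      f (aeval (sixTraces k) a) = eval (fun i => f (sixTraces k i)) a := by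
    rw [← AlgHom.comp_apply, MvPolynomial.comp_aeval, ← MvPolynomial.coe_aeval_eq_eval]
    rfl
  obtain ⟨χ, h1, h2⟩ := exists_character (fun i => f (sixTraces k i)) (f (tripleTrace k)) (by
    rw [← map_pow, tripleTrace_sq, map_add, map_mul, hf, hf])
  refine ⟨χ, fun h => ?_, fun ψ hψ => ?_⟩
  · obtain ⟨a, b, rfl⟩ := exists_eq_add_mul_tripleTrace h
    rw [← evalAt_apply]
    simp only [map_add, map_mul, hf, evalAt_aeval, h1, h2]
  · refine characterVariety_ext (funext fun i => ?_) ?_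
    · rw [h1]; exact (hψ _).symm
    · exact (hψ (tripleTrace k)).symm.trans h2.symm

end CoordRing

theorem mainTheorem7 {k : Type*} [Field k] [IsAlgClosed k] :
    -- `𝔛_3` is an irreducible affine variety with the given ring of functions:
    -- its points are exactly the `k`-points of the ring
    IsDomain (characterCoordRing (FreeGroup (Fin 3)) 2 k) ∧
    (characterCoordRing (FreeGroup (Fin 3)) 2 k).FG ∧
    (∀ f : characterCoordRing (FreeGroup (Fin 3)) 2 k →ₐ[k] k,
      ∃! χ : CharacterVariety (FreeGroup (Fin 3)) 2 k, ∀ h, f h = h.1 χ) ∧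
    -- the six traces are transcendental generators
    IsTranscendenceBasis k (sixTraces k) ∧
    -- the ring of functions is an extension of degree 2, finite and free
    Module.Finite (sixTraceSubring k) (characterCoordRing (FreeGroup (Fin 3)) 2 k) ∧
    Module.Free (sixTraceSubring k) (characterCoordRing (FreeGroup (Fin 3)) 2 k) ∧
    Module.finrank (sixTraceSubring k) (characterCoordRing (FreeGroup (Fin 3)) 2 k) = 2 ∧
    -- `𝔛_3 → k^6` is a double cover, ramified over the hypersurface of the discriminant
    Function.Surjective (sixTraceMap k) ∧
    (∀ p : Fin 6 → k, branchDiscr p ≠ 0 → (sixTraceMap k ⁻¹' {p}).encard = 2) ∧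
    (∀ p : Fin 6 → k, branchDiscr p = 0 → (sixTraceMap k ⁻¹' {p}).encard = 1) ∧
    (∃ p : Fin 6 → k, branchDiscr p ≠ 0) ∧
    (∃ p : Fin 6 → k, branchDiscr p = 0) :=
  ⟨isDomain_characterCoordRing, fg_characterCoordRing k, existsUnique_point,
    isTranscendenceBasis_sixTraces k, finite_characterCoordRing k,
    Module.Free.of_basis (coordRingBasis k), finrank_characterCoordRing k,
    sixTraceMap_surjective, encard_fibre_of_ne_zero, encard_fibre_of_eq_zero,
    exists_branchDiscr_ne_zero k, exists_branchDiscr_eq_zero k⟩
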